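/- Let $\mathbb K=\mathbb R$ or $\mathbb C$. Let $E_1$ be a finite-dimensional normed space over $\mathbb K$ with a linear subspace $E_2\subseteq E_1$, and let $X_1$ be a Banach space over $\mathbb K$ with a closed linear subspace $X_2\subseteq X_1$. Write $$\mathcal L\big((E_1,E_2);(X_1,X_2)\big)=\{S\in\mathcal L(E_1;X_1) : S(E_2)\subseteq X_2\},$$ with the operator norm, and regard $X_2^{**}$ as a subspace of $X_1^{**}$ through the second adjoint of the inclusion $X_2\hookrightarrow X_1$ (equivalently, $X_2^{**}\equiv X_2^{\perp\perp}\subseteq X_1^{**}$). For $e\in E_1$ and $x^*\in X_1^*$ let $e\otimes x^*$ denote the functional $S\mapsto x^*(Se)$ on $\mathcal L((E_1,E_2);(X_1,X_2))$. Then the map $$\varphi\mapsto\tilde\varphi,\qquad (\tilde\varphi e)(x^*)=\varphi(e\otimes x^*)\quad(e\in E_1,\ x^*\in X_1^*),$$ is a well-defined linear isometric isomorphism from $\mathcal L((E_1,E_2);(X_1,X_2))^{**}$ onto $$\mathcal L\big((E_1,E_2);(X_1^{**},X_2^{**})\big)=\{T\in\mathcal L(E_1;X_1^{**}) : T(E_2)\subseteq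 X_2^{**}\}.$$ -/

import Mathlib

/-- For subspaces `E₂` of `E₁` and `X₂` of `X₁`, the subspace of `L(E₁;X₁)` of all bounded linear
operators `S : E₁ → X₁` with `S(E₂) ⊆ X₂`. -/
def pairSubmodule {𝕜 E X : Type*} [RCLike 𝕜]
    [NormedAddCommGroup E] [NormedSpace 𝕜 E] [NormedAddCommGroup X] [NormedSpace 𝕜 X]
    (E₂ : Submodule 𝕜 E) (X₂ : Submodule 𝕜 X) : Submodule 𝕜 (E →L[𝕜] X) where
  carrier := {S | ∀ e ∈ E₂, S e ∈ X₂}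
  add_mem' hS hT e he := X₂.add_mem (hS e he) (hT e he)
  zero_mem' _ _ := X₂.zero_mem
  smul_mem' c _ hS e he := X₂.smul_mem c (hS e he)

/-- The space `L((E₁,E₂);(X₁,X₂))` of all bounded linear `S : E₁ → X₁` with `S(E₂) ⊆ X₂`, as a
normed space with the operator norm of `L(E₁;X₁)`. -/
def PairOperators {𝕜 E X : Type*} [RCLike 𝕜]
    [NormedAddCommGroup E] [NormedSpace 𝕜 E] [NormedAddCommGroup X] [NormedSpace 𝕜 X]
    (E₂ : Submodule 𝕜 E) (X₂ : Submodule 𝕜 X) : Type _ :=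
  ↥(pairSubmodule E₂ X₂)

noncomputable instance {𝕜 E X : Type*} [RCLike 𝕜]
    [NormedAddCommGroup E] [NormedSpace 𝕜 E] [NormedAddCommGroup X] [NormedSpace 𝕜 X]
    (E₂ : Submodule 𝕜 E) (X₂ : Submodule 𝕜 X) : NormedAddCommGroup (PairOperators E₂ X₂) :=
  inferInstanceAs (NormedAddCommGroup ↥(pairSubmodule E₂ X₂))

noncomputable instance {𝕜 E X : Type*} [RCLike 𝕜]
    [NormedAddCommGroup E] [NormedSpace 𝕜 E] [NormedAddCommGroup X] [NormedSpace 𝕜 X]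
    (E₂ : Submodule 𝕜 E) (X₂ : Submodule 𝕜 X) : NormedSpace 𝕜 (PairOperators E₂ X₂) :=
  inferInstanceAs (NormedSpace 𝕜 ↥(pairSubmodule E₂ X₂))

/-- An element of `L((E₁,E₂);(X₁,X₂))` as an operator in `L(E₁;X₁)`. -/
def PairOperators.toCLM {𝕜 E X : Type*} [RCLike 𝕜]
    [NormedAddCommGroup E] [NormedSpace 𝕜 E] [NormedAddCommGroup X] [NormedSpace 𝕜 X]
    {E₂ : Submodule 𝕜 E} {X₂ : Submodule 𝕜 X} (S : PairOperators E₂ X₂) : E →L[𝕜] X :=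
  S.1

/-- The adjoint `T* : Y* → X*`, `y* ↦ y* ∘ T`, of a bounded linear operator `T : X → Y`. -/
noncomputable def adjointMap {𝕜 X Y : Type*} [RCLike 𝕜]
    [NormedAddCommGroup X] [NormedSpace 𝕜 X] [NormedAddCommGroup Y] [NormedSpace 𝕜 Y]
    (T : X →L[𝕜] Y) : StrongDual 𝕜 Y →L[𝕜] StrongDual 𝕜 X :=
  ContinuousLinearMap.precomp 𝕜 T

/-- The bidual `X₂**` of a subspace `X₂` of `X₁`, regarded as a subspace of `X₁**`: the range of the
second adjoint `X₂** → X₁**` of the inclusion `X₂ → X₁`. -/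
noncomputable def bidualSubspace {𝕜 X : Type*} [RCLike 𝕜]
    [NormedAddCommGroup X] [NormedSpace 𝕜 X] (X₂ : Submodule 𝕜 X) :
    Submodule 𝕜 (StrongDual 𝕜 (StrongDual 𝕜 X)) :=
  (adjointMap (adjointMap X₂.subtypeL)).range

/-- The functional `e ⊗ x*` on `L((E₁,E₂);(X₁,X₂))`, given by `S ↦ x*(S e)`. -/
noncomputable def tensorFunctional {𝕜 E X : Type*} [RCLike 𝕜]
    [NormedAddCommGroup E] [NormedSpace 𝕜 E] [NormedAddCommGroup X] [NormedSpace 𝕜 X]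
    (E₂ : Submodule 𝕜 E) (X₂ : Submodule 𝕜 X) (e : E) (x' : StrongDual 𝕜 X) :
    StrongDual 𝕜 (PairOperators E₂ X₂) :=
  LinearMap.mkContinuous
    { toFun := fun S => x' (S.toCLM e)
      map_add' := fun S T => x'.map_add (S.toCLM e) (T.toCLM e)
      map_smul' := fun c S => x'.map_smul c (S.toCLM e) }
    (‖x'‖ * ‖e‖)
    (fun S => by
      have h1 : ‖x' (S.toCLM e)‖ ≤ ‖x'‖ * ‖S.toCLM e‖ := x'.le_opNorm _
      have h2 : ‖S.toCLM e‖ ≤ ‖S‖ * ‖e‖ := S.toCLM.le_opNorm e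
      have h3 := mul_le_mul_of_nonneg_left h2 (norm_nonneg x')
      calc ‖x' (S.toCLM e)‖ ≤ ‖x'‖ * (‖S‖ * ‖e‖) := h1.trans h3
        _ = ‖x'‖ * ‖e‖ * ‖S‖ := by ring)

/-!
For `φ` in the bidual of `L((E₁,E₂);(X₁,X₂))`, the operator `φ̃` is bounded by `‖φ‖` since
`‖e ⊗ x*‖ ≤ ‖e‖ ‖x*‖`. It maps `e ∈ E₂` into `X₂**` because `φ̃ e` is the image of `φ` under the
second adjoint of the evaluation `S ↦ S e`, which factors through `X₂`.

The lower bound `‖φ‖ ≤ ‖φ̃‖` comes from a description of the functionals on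
`L((E₁,E₂);(X₁,X₂))`. The unit ball of the finite-dimensional space `E₁` has a finite net
`e₁, …, e_N` with `‖S‖ ≤ c max ‖S e_j‖` for all `S`, where `c > 1` is arbitrarily close to `1`
(`exists_finset_opNorm_le`). So `S ↦ (S e_j)_j` is almost isometric into `ℓ_∞^N(X₁)`, and by
Hahn–Banach and the estimate for the dual `ℓ_1^N(X₁*)` (`sum_norm_comp_single_le`) every functional
`f` is a sum `∑ e_j ⊗ x_j*` with `∑ ‖x_j*‖ ≤ c ‖f‖` (`exists_eq_sum_tensorFunctional`). Hence
`|φ f| = |∑ (φ̃ e_j)(x_j*)| ≤ c ‖φ̃‖ ‖f‖`.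

For surjectivity, a projection `P` of `E₁` onto `E₂` splits each operator as `S = S P + S (1 - P)`.
With bases of `E₂` and `E₁` this reconstructs `S` from finitely many values, those on `E₂` lying in
`X₂`; taking second adjoints of the corresponding rank one embeddings of `X₂` and `X₁` yields a
preimage of any `T` (`exists_apply_tensorFunctional_eq`).
-/

/-! ### Norming nets and the dual of a finite `ℓ_∞` sum -/

section Norming

variable {𝕜 : Type*} [RCLike 𝕜]

/-- The part of the duality between `ℓ_∞(ι; X)` and `ℓ_1(ι; X*)` that bounds the `ℓ_1` norm. -/
theorem sum_norm_comp_single_le {ι X : Type*} [Fintype ι] [DecidableEq ι]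
    [NormedAddCommGroup X] [NormedSpace 𝕜 X] (g : StrongDual 𝕜 (ι → X)) :
    ∑ i, ‖g.comp (ContinuousLinearMap.single 𝕜 (fun _ : ι => X) i)‖ ≤ ‖g‖ := by
  set G : ι → StrongDual 𝕜 X := fun i =>
    g.comp (ContinuousLinearMap.single 𝕜 (fun _ : ι => X) i)
  -- Nearly norming vectors for each component, rotated so that the values are nonnegative reals.
  have key : ∀ η : ℝ, 0 < η → ∀ i, ∃ x : X, ‖x‖ ≤ 1 ∧ ∃ r : ℝ, G i x = (r : 𝕜) ∧ ‖G i‖ - η ≤ r := by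
    intro η hη i
    obtain ⟨x, hx, hlt⟩ : ∃ x : X, ‖x‖ ≤ 1 ∧ ‖G i‖ - η ≤ ‖G i x‖ := by
      by_contra! h
      have h0 := h 0 (by simp)
      rw [map_zero, norm_zero] at h0
      have := ContinuousLinearMap.opNorm_le_of_unit_norm (𝕜 := 𝕜) (f := G i) h0.le
        fun x hx => (h x hx.le).le
      linarith
    obtain ⟨v, hv, hvx⟩ := RCLike.exists_norm_eq_mul_self (G i x)
    exact ⟨v • x, by rw [norm_smul, hv, one_mul]; exact hx, ‖G i x‖, by
      rw [map_smul, smul_eq_mul, hvx], hlt⟩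
  have bound : ∀ η : ℝ, 0 < η → ∑ i, ‖G i‖ ≤ ‖g‖ + Fintype.card ι * η := by
    intro η hη
    choose x hx r hr hle using key η hη
    have hgx : g x = ((∑ i, r i : ℝ) : 𝕜) := by
      conv_lhs => rw [← Finset.univ_sum_single x]
      rw [map_sum, RCLike.ofReal_sum]
      exact Finset.sum_congr rfl fun i _ => hr i
    have h1 : ‖g x‖ ≤ ‖g‖ := by
      refine (g.le_opNorm x).trans (mul_le_of_le_one_right (norm_nonneg _) ?_)
      exact (pi_norm_le_iff_of_nonneg zero_le_one).2 hx
    rw [hgx, RCLike.norm_ofReal] at h1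
    have h2 : ∑ i, (‖G i‖ - η) ≤ ∑ i, r i := Finset.sum_le_sum fun i _ => hle i
    rw [Finset.sum_sub_distrib, Finset.sum_const, Finset.card_univ, nsmul_eq_mul] at h2
    linarith [le_abs_self (∑ i, r i)]
  refine le_of_forall_pos_le_add fun ε hε => ?_
  refine (bound (ε / (Fintype.card ι + 1)) (by positivity)).trans ?_
  gcongr
  rw [mul_div_assoc', div_le_iff₀ (by positivity)]
  nlinarith

/-- A fine finite net of the unit ball of a finite-dimensional space is norming, up to a factor
arbitrarily close to `1`, for all operators on that space simultaneously. -/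
theorem exists_finset_opNorm_le (𝕜 : Type*) [RCLike 𝕜] (E X : Type*)
    [NormedAddCommGroup E] [NormedSpace 𝕜 E]
    [FiniteDimensional 𝕜 E] [NormedAddCommGroup X] [NormedSpace 𝕜 X] {c : ℝ} (hc : 1 < c) :
    ∃ s : Finset E, (∀ e ∈ s, ‖e‖ ≤ 1) ∧
      ∀ S : E →L[𝕜] X, ‖S‖ ≤ c * ‖fun e : s => S (e : E)‖ := by
  have : ProperSpace E := FiniteDimensional.proper_rclike 𝕜 E
  have hc0 : 0 < c := by linarith
  -- The mesh `δ` is chosen so that `1 / (1 - δ) = c`.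
  set δ : ℝ := 1 - c⁻¹ with hδ
  have hδ0 : 0 < δ := by rw [hδ]; linarith [inv_lt_one_of_one_lt₀ hc]
  obtain ⟨t, ht, htf, hcov⟩ := (isCompact_closedBall (0 : E) 1).finite_cover_balls hδ0
  refine ⟨htf.toFinset, fun e he => by simpa using ht ((Set.Finite.mem_toFinset _).1 he), ?_⟩
  intro S
  set M := ‖fun e : htf.toFinset => S (e : E)‖
  have hS : ‖S‖ ≤ M + ‖S‖ * δ := by
    refine ContinuousLinearMap.opNorm_le_of_unit_norm (𝕜 := 𝕜) (by positivity) fun x hx => ?_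
    obtain ⟨e, het, hxe⟩ := Set.mem_iUnion₂.1 (hcov (by simp [hx] : x ∈ Metric.closedBall (0 : E) 1))
    have h1 : ‖S e‖ ≤ M :=
      norm_le_pi_norm (fun e : htf.toFinset => S (e : E)) ⟨e, htf.mem_toFinset.2 het⟩
    have h2 : ‖S (x - e)‖ ≤ ‖S‖ * δ :=
      S.le_opNorm_of_le (by rw [← dist_eq_norm]; exact (Metric.mem_ball.1 hxe).le)
    calc ‖S x‖ = ‖S e + S (x - e)‖ := by rw [← map_add, add_sub_cancel]
      _ ≤ M + ‖S‖ * δ := (norm_add_le _ _).trans (add_le_add h1 h2)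
  have h3 : ‖S‖ * c⁻¹ ≤ M := by rw [hδ] at hS; linarith
  rw [← div_eq_mul_inv, div_le_iff₀ hc0] at h3
  linarith

end Norming

section Pair

variable {𝕜 E X : Type*} [RCLike 𝕜]
    [NormedAddCommGroup E] [NormedSpace 𝕜 E] [NormedAddCommGroup X] [NormedSpace 𝕜 X]

theorem norm_tensorFunctional_le (E₂ : Submodule 𝕜 E) (X₂ : Submodule 𝕜 X) (e : E)
    (x' : StrongDual 𝕜 X) : ‖tensorFunctional E₂ X₂ e x'‖ ≤ ‖x'‖ * ‖e‖ :=
  LinearMap.mkContinuous_norm_le _ (by positivity) _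

@[simp]
theorem tensorFunctional_apply (E₂ : Submodule 𝕜 E) (X₂ : Submodule 𝕜 X) (e : E)
    (x' : StrongDual 𝕜 X) (S : PairOperators E₂ X₂) :
    tensorFunctional E₂ X₂ e x' S = x' (S.toCLM e) := rfl

/-! ### Functionals on the space of pair operators -/

/-- Every functional on `L((E₁,E₂);(X₁,X₂))` is a sum of elementary tensors whose projective norm is
almost the norm of the functional. -/
theorem exists_eq_sum_tensorFunctional [FiniteDimensional 𝕜 E] (E₂ : Submodule 𝕜 E)
    (X₂ : Submodule 𝕜 X) (f : StrongDual 𝕜 (PairOperators E₂ X₂)) {c : ℝ} (hc : 1 < c) :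
    ∃ (s : Finset E) (x' : s → StrongDual 𝕜 X), (∀ e ∈ s, ‖e‖ ≤ 1) ∧
      f = ∑ e : s, tensorFunctional E₂ X₂ e (x' e) ∧ ∑ e, ‖x' e‖ ≤ c * ‖f‖ := by
  classical
  obtain ⟨s, hs, hnorm⟩ := exists_finset_opNorm_le 𝕜 E X hc
  let J : PairOperators E₂ X₂ →ₗ[𝕜] (s → X) :=
    { toFun := fun S e => S.toCLM e
      map_add' := fun _ _ => rfl
      map_smul' := fun _ _ => rfl }
  have hJ : ∀ S, ‖S‖ ≤ c * ‖J S‖ := fun S => hnorm S.toCLM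
  have hinj : Function.Injective J := by
    refine (injective_iff_map_eq_zero J).2 fun S hS => norm_le_zero_iff.1 ?_
    simpa [hS] using hJ S
  let Je := LinearEquiv.ofInjective J hinj
  let f₀ : StrongDual 𝕜 (LinearMap.range J) :=
    (f.toLinearMap ∘ₗ Je.symm.toLinearMap).mkContinuous (c * ‖f‖) fun y => by
      have h := hJ (Je.symm y)
      have hy : J (Je.symm y) = y := congrArg Subtype.val (Je.apply_symm_apply y)
      rw [hy] at h
      calc ‖f (Je.symm y)‖ ≤ ‖f‖ * (c * ‖y‖) := f.le_opNorm_of_le h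
        _ = c * ‖f‖ * ‖y‖ := by ring
  have hf₀ : ‖f₀‖ ≤ c * ‖f‖ := LinearMap.mkContinuous_norm_le _ (by positivity) _
  obtain ⟨g, hg, hgn⟩ := exists_extension_norm_eq _ f₀
  refine ⟨s, fun e => g.comp (ContinuousLinearMap.single 𝕜 (fun _ : s => X) e), hs, ?_,
    (sum_norm_comp_single_le g).trans (hgn.trans_le hf₀)⟩
  ext S
  have h1 : g (J S) = f S := by
    refine (hg (Je S)).trans ?_
    change f (Je.symm (Je S)) = f S
    rw [Je.symm_apply_apply]
  rw [← h1, ← Finset.univ_sum_single (J S), map_sum, sum_apply]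
  rfl

/-! ### The operator induced by an element of the bidual -/

/-- Evaluation at a point of `E₂`, as an operator with values in `X₂`. -/
noncomputable def evalSubmodule (E₂ : Submodule 𝕜 E) (X₂ : Submodule 𝕜 X) (e : E₂) :
    PairOperators E₂ X₂ →L[𝕜] X₂ :=
  LinearMap.mkContinuous
    { toFun := fun S => ⟨S.toCLM e, S.2 e e.2⟩
      map_add' := fun _ _ => rfl
      map_smul' := fun _ _ => rfl }
    ‖e‖ (fun S => by
      rw [mul_comm]
      exact S.toCLM.le_opNorm e)

/-- The operator `φ̃ : E₁ → X₁**`, `(φ̃ e)(x*) = φ (e ⊗ x*)`. It maps `E₂` into `X₂**` since, for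
`e ∈ E₂`, the second adjoint of the evaluation at `e` sends `φ` to an element of `X₂**`. -/
noncomputable def inducedOperator (E₂ : Submodule 𝕜 E) (X₂ : Submodule 𝕜 X)
    (φ : StrongDual 𝕜 (StrongDual 𝕜 (PairOperators E₂ X₂))) :
    PairOperators (X := StrongDual 𝕜 (StrongDual 𝕜 X)) E₂ (bidualSubspace X₂) :=
  ⟨LinearMap.mkContinuous₂
    (LinearMap.mk₂ 𝕜 (fun e x' => φ (tensorFunctional E₂ X₂ e x'))
      (fun e₁ e₂ x' => by
        rw [← map_add]; congr 1; ext S; simp)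
      (fun a e x' => by
        rw [← map_smul]; congr 1; ext S; simp)
      (fun e x₁ x₂ => by
        rw [← map_add]; congr 1)
      (fun a e x' => by
        rw [← map_smul]; congr 1))
    ‖φ‖ (fun e x' => by
      rw [LinearMap.mk₂_apply, mul_assoc, mul_comm ‖e‖]
      exact φ.le_opNorm_of_le (norm_tensorFunctional_le E₂ X₂ e x')),
    fun e he => ⟨adjointMap (adjointMap (evalSubmodule E₂ X₂ ⟨e, he⟩)) φ, rfl⟩⟩

theorem inducedOperator_toCLM_apply (E₂ : Submodule 𝕜 E) (X₂ : Submodule 𝕜 X)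
    (φ : StrongDual 𝕜 (StrongDual 𝕜 (PairOperators E₂ X₂))) (e : E) (x' : StrongDual 𝕜 X) :
    (inducedOperator E₂ X₂ φ).toCLM e x' = φ (tensorFunctional E₂ X₂ e x') := rfl

theorem norm_inducedOperator_le (E₂ : Submodule 𝕜 E) (X₂ : Submodule 𝕜 X)
    (φ : StrongDual 𝕜 (StrongDual 𝕜 (PairOperators E₂ X₂))) :
    ‖inducedOperator E₂ X₂ φ‖ ≤ ‖φ‖ :=
  (inducedOperator E₂ X₂ φ).toCLM.opNorm_le_bound₂ (norm_nonneg φ) fun e x' => by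
    rw [inducedOperator_toCLM_apply, mul_assoc, mul_comm ‖e‖]
    exact φ.le_opNorm_of_le (norm_tensorFunctional_le E₂ X₂ e x')

theorem le_norm_inducedOperator [FiniteDimensional 𝕜 E] (E₂ : Submodule 𝕜 E) (X₂ : Submodule 𝕜 X)
    (φ : StrongDual 𝕜 (StrongDual 𝕜 (PairOperators E₂ X₂))) :
    ‖φ‖ ≤ ‖inducedOperator E₂ X₂ φ‖ := by
  set T := (inducedOperator E₂ X₂ φ).toCLM
  change ‖φ‖ ≤ ‖T‖
  refine φ.opNorm_le_bound (norm_nonneg _) fun f => ?_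
  have key : ∀ c : ℝ, 1 < c → ‖φ f‖ ≤ ‖T‖ * ‖f‖ * c := by
    intro c hc
    obtain ⟨s, x', hs, hf, hx'⟩ := exists_eq_sum_tensorFunctional E₂ X₂ f hc
    calc ‖φ f‖ = ‖∑ e : s, T e (x' e)‖ := by
          conv_lhs => rw [hf, map_sum]
          rfl
      _ ≤ ∑ e : s, ‖T‖ * ‖x' e‖ := norm_sum_le_of_le _ fun e _ =>
          (T e).le_of_opNorm_le (T.unit_le_opNorm e (hs e e.2)) _
      _ = ‖T‖ * ∑ e : s, ‖x' e‖ := by rw [Finset.mul_sum]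
      _ ≤ ‖T‖ * (c * ‖f‖) := by gcongr
      _ = ‖T‖ * ‖f‖ * c := by ring
  have hlim : Filter.Tendsto (fun c : ℝ => ‖T‖ * ‖f‖ * c) (nhdsWithin 1 (Set.Ioi 1))
      (nhds (‖T‖ * ‖f‖ * 1)) :=
    ((continuous_const.mul continuous_id).tendsto 1).mono_left nhdsWithin_le_nhds
  rw [mul_one] at hlim
  exact ge_of_tendsto hlim (Filter.eventually_of_mem self_mem_nhdsWithin key)

theorem inducedOperator_injective [FiniteDimensional 𝕜 E] (E₂ : Submodule 𝕜 E)
    (X₂ : Submodule 𝕜 X) : Function.Injective (inducedOperator E₂ X₂) := fun φ ψ h => by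
  refine sub_eq_zero.1 (norm_le_zero_iff.1 ((le_norm_inducedOperator E₂ X₂ (φ - ψ)).trans_eq ?_))
  have : inducedOperator E₂ X₂ (φ - ψ) = inducedOperator E₂ X₂ φ - inducedOperator E₂ X₂ ψ := rfl
  rw [this, h, sub_self, norm_zero]

/-! ### Surjectivity -/

/-- The rank one embedding `x ↦ (e ↦ p(e) x)` of `X₂` into `L((E₁,E₂);(X₁,X₂))`. -/
noncomputable def smulRightSubmodule (E₂ : Submodule 𝕜 E) (X₂ : Submodule 𝕜 X)
    (p : StrongDual 𝕜 E) : X₂ →L[𝕜] PairOperators E₂ X₂ :=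
  LinearMap.mkContinuous
    { toFun := fun x => ⟨p.smulRight (x : X), fun e _ => X₂.smul_mem (p e) x.2⟩
      map_add' := fun _ _ => Subtype.ext (ContinuousLinearMap.ext fun _ => smul_add _ _ _)
      map_smul' := fun _ _ => Subtype.ext (ContinuousLinearMap.ext fun _ => smul_comm _ _ _) }
    ‖p‖ (fun x => (ContinuousLinearMap.norm_smulRight_apply p (x : X)).le)

/-- The rank one embedding `x ↦ (e ↦ p(e) x)` of `X₁` into `L((E₁,E₂);(X₁,X₂))`, for a functional
`p` that vanishes on `E₂`. -/
noncomputable def smulRightOfVanishing (E₂ : Submodule 𝕜 E) (X₂ : Submodule 𝕜 X)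
    (p : StrongDual 𝕜 E) (hp : ∀ e ∈ E₂, p e = 0) : X →L[𝕜] PairOperators E₂ X₂ :=
  LinearMap.mkContinuous
    { toFun := fun x => ⟨p.smulRight x, fun e he => by simp [hp e he]⟩
      map_add' := fun _ _ => Subtype.ext (ContinuousLinearMap.ext fun _ => smul_add _ _ _)
      map_smul' := fun _ _ => Subtype.ext (ContinuousLinearMap.ext fun _ => smul_comm _ _ _) }
    ‖p‖ (fun x => (ContinuousLinearMap.norm_smulRight_apply p x).le)

/-- Every `T` in `L((E₁,E₂);(X₁**,X₂**))` is induced by an element of the bidual. -/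
theorem exists_apply_tensorFunctional_eq [FiniteDimensional 𝕜 E] (E₂ : Submodule 𝕜 E)
    (X₂ : Submodule 𝕜 X)
    (T : PairOperators (X := StrongDual 𝕜 (StrongDual 𝕜 X)) E₂ (bidualSubspace X₂)) :
    ∃ φ : StrongDual 𝕜 (StrongDual 𝕜 (PairOperators E₂ X₂)),
      ∀ e x', φ (tensorFunctional E₂ X₂ e x') = T.toCLM e x' := by
  obtain ⟨P, hP⟩ := E₂.subtype.exists_leftInverse_of_injective E₂.ker_subtype
  replace hP : ∀ e : E₂, P e = e := fun e => LinearMap.congr_fun hP e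
  -- Then `e = ∑ p_j(e) a_j + ∑ q_i(e) b_i`, with `p_j` the coordinates of `P e` and `q_i` those of
  -- `e - P e`; the `q_i` vanish on `E₂`, so only the values `T a_j` have to lie in `X₂**`.
  let b := Module.finBasis 𝕜 E
  let a := Module.finBasis 𝕜 E₂
  let p := fun j => LinearMap.toContinuousLinearMap (a.coord j ∘ₗ P)
  let q := fun i => LinearMap.toContinuousLinearMap
    (b.coord i ∘ₗ (LinearMap.id - E₂.subtype ∘ₗ P))
  have hq : ∀ i, ∀ e ∈ E₂, q i e = 0 := fun i e he => by
    have := hP ⟨e, he⟩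
    simp only at this
    simp [q, this]
  choose t ht using fun j => T.2 (a j) (a j).2
  refine ⟨∑ j, adjointMap (adjointMap (smulRightSubmodule E₂ X₂ (p j))) (t j) +
    ∑ i, adjointMap (adjointMap (smulRightOfVanishing E₂ X₂ (q i) (hq i))) (T.toCLM (b i)), ?_⟩
  intro e x'
  have h1 : ∀ j, adjointMap (adjointMap (smulRightSubmodule E₂ X₂ (p j))) (t j)
      (tensorFunctional E₂ X₂ e x') = p j e * T.toCLM (a j) x' := by
    intro j
    have : adjointMap (smulRightSubmodule E₂ X₂ (p j)) (tensorFunctional E₂ X₂ e x') =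
        p j e • adjointMap X₂.subtypeL x' := by
      ext x
      exact x'.map_smul (p j e) (x : X)
    change t j (adjointMap (smulRightSubmodule E₂ X₂ (p j)) _) = _
    rw [this, map_smul, smul_eq_mul]
    exact congrArg (p j e * ·) (DFunLike.congr_fun (ht j) x')
  have h2 : ∀ i, adjointMap (adjointMap (smulRightOfVanishing E₂ X₂ (q i) (hq i))) (T.toCLM (b i))
      (tensorFunctional E₂ X₂ e x') = q i e * T.toCLM (b i) x' := by
    intro i
    have : adjointMap (smulRightOfVanishing E₂ X₂ (q i) (hq i)) (tensorFunctional E₂ X₂ e x') =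
        q i e • x' := by
      ext x
      exact x'.map_smul (q i e) x
    change T.toCLM (b i) (adjointMap (smulRightOfVanishing E₂ X₂ (q i) (hq i)) _) = _
    rw [this, map_smul, smul_eq_mul]
  have h3 : ∑ j, p j e • (a j : E) = P e := by
    have := congrArg E₂.subtype (a.sum_repr (P e))
    rwa [map_sum] at this
  have h4 : ∑ i, q i e • b i = e - P e := b.sum_repr (e - P e)
  have h5 : e = ∑ j, p j e • (a j : E) + ∑ i, q i e • b i := by rw [h3, h4]; abel
  conv_rhs => rw [h5]
  simp only [map_add, map_sum, map_smul, add_apply,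
    sum_apply, h1, h2, smul_apply, smul_eq_mul]

theorem inducedOperator_surjective [FiniteDimensional 𝕜 E] (E₂ : Submodule 𝕜 E)
    (X₂ : Submodule 𝕜 X) : Function.Surjective (inducedOperator E₂ X₂) := fun T => by
  obtain ⟨φ, hφ⟩ := exists_apply_tensorFunctional_eq E₂ X₂ T
  exact ⟨φ, Subtype.ext
    (ContinuousLinearMap.ext fun e => ContinuousLinearMap.ext fun x' => hφ e x')⟩

/-- The map `φ ↦ φ̃` as a linear isometric isomorphism. -/
noncomputable def inducedOperatorEquiv [FiniteDimensional 𝕜 E] (E₂ : Submodule 𝕜 E)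
    (X₂ : Submodule 𝕜 X) :
    StrongDual 𝕜 (StrongDual 𝕜 (PairOperators E₂ X₂)) ≃ₗᵢ[𝕜]
      PairOperators (X := StrongDual 𝕜 (StrongDual 𝕜 X)) E₂ (bidualSubspace X₂) where
  toFun := inducedOperator E₂ X₂
  map_add' _ _ := rfl
  map_smul' _ _ := rfl
  invFun := Function.surjInv (inducedOperator_surjective E₂ X₂)
  left_inv := Function.leftInverse_surjInv
    ⟨inducedOperator_injective E₂ X₂, inducedOperator_surjective E₂ X₂⟩
  right_inv := Function.rightInverse_surjInv (inducedOperator_surjective E₂ X₂)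
  norm_map' φ := (norm_inducedOperator_le E₂ X₂ φ).antisymm (le_norm_inducedOperator E₂ X₂ φ)

end Pair

theorem mainTheorem4 {𝕜 E₁ X₁ : Type*} [RCLike 𝕜]
    [NormedAddCommGroup E₁] [NormedSpace 𝕜 E₁] [FiniteDimensional 𝕜 E₁]
    [NormedAddCommGroup X₁] [NormedSpace 𝕜 X₁] [CompleteSpace X₁]
    (E₂ : Submodule 𝕜 E₁) (X₂ : Submodule 𝕜 X₁) (hX₂ : IsClosed (X₂ : Set X₁)) :
    ∃ Φ : StrongDual 𝕜 (StrongDual 𝕜 (PairOperators E₂ X₂)) ≃ₗᵢ[𝕜]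
        PairOperators (X := StrongDual 𝕜 (StrongDual 𝕜 X₁)) E₂ (bidualSubspace X₂),
      ∀ (φ : StrongDual 𝕜 (StrongDual 𝕜 (PairOperators E₂ X₂))) (e : E₁) (x' : StrongDual 𝕜 X₁),
        (Φ φ).toCLM e x' = φ (tensorFunctional E₂ X₂ e x') := by
  exact ⟨inducedOperatorEquiv E₂ X₂, inducedOperator_toCLM_apply E₂ X₂⟩
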